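/- Let $B$ be a real separable F-space (a real topological vector space whose topology is given by a translation-invariant, complete, separable metric), let $X$ be a $B$-valued random vector on a probability space $(\Omega,\mathcal F,P)$, measurable with respect to the Borel sets of $B$, and let $\mu$ be its law. Let $t_k : B\to\mathbb{R}$, $k\ge 1$, be Borel measurable functionals (not necessarily linear or continuous) such that the random variables $t_k(X)$, $k\ge1$, are independent and symmetric about $0$, with variances $\sigma_k^2\in(0,\infty)$. For a family $\mathcal T$ of real measurable functionals on a measurable space $E$, a probability measure $\nu$ on $E$ and $b\in E$, put $$HD_{\mathcal T}(b,\nu)=\inf_{t\in\mathcal T}\nu\{x\in E: t(x)\ge t(b)\},$$ and write $HD_{\mathbb{R}^d}$ when $E=\mathbb{R}^d$ and $\mathcal T$ consists of all linear functionals on $\mathbb{R}^d$. Let $a\in B$, and assume that (A-I) and (A-II) hold, or that (A-III) holds, where: (A-I) for every integer $d\ge1$, $HD_{\mathbb{R}^d}(\Pi_d(a),\mu\circ\Pi_d^{-1})>0$, where $\Pi_d(x)=(t_1(x),\dots,t_d(x))$ for $x\in B$; (A-II) there is a constant $c<\infty$ such that $\mathbb{E}(t_k(X)^4)\le c\,[\mathbb{E}(t_k(X)^2)]^2$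 for all $k\ge1$; (A-III) there are numbers $0<\lambda_k<\infty$ such that the random variables $t_k(X)/\lambda_k$, $k\ge1$, are i.i.d. with a probability density $\phi$ that is positive almost everywhere, absolutely continuous on every compact interval, and satisfies $\int_{\mathbb{R}}\frac{(\phi'(x))^2}{\phi(x)}\,dx<\infty$ and $\int_{\mathbb{R}}x^2\phi(x)\,dx<\infty$. Let $\mathcal T$ be the set of all finite real linear combinations of the $t_k$, $k\ge1$. Then $$HD_{\mathcal T}(a,\mu)>0\quad\text{if and only if}\quad\sum_{k\ge1}\frac{t_k(a)^2}{\sigma_k^2}<\infty.$$ -/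

import Mathlib

open MeasureTheory ProbabilityTheory

/-- The half-space depth of `a` with respect to a family `T` of real functionals on `E` and a
measure `μ`: the infimum over `t ∈ T` of `μ {x | t x ≥ t a}`. -/
noncomputable def halfSpaceDepth {E : Type*} [MeasurableSpace E] (T : Set (E → ℝ)) (a : E)
    (μ : Measure E) : ENNReal :=
  ⨅ t ∈ T, μ {x | t a ≤ t x}

/-- Tukey's half-space depth on `ℝ^d`, computed with all linear functionals. -/
noncomputable def tukeyDepth (d : ℕ) (a : Fin d → ℝ) (μ : Measure (Fin d → ℝ)) : ENNReal :=
  halfSpaceDepth (Set.range fun l : (Fin d → ℝ) →ₗ[ℝ] ℝ => (l : (Fin d → ℝ) → ℝ)) a μ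

/-- All finite (real) linear combinations of the functionals `t k`. -/
def finiteCombinations {E : Type*} (t : ℕ → E → ℝ) : Set (E → ℝ) :=
  (Submodule.span ℝ (Set.range t) : Set (E → ℝ))

/-- For every `d ≥ 1`, the vector `(t 0 a, …, t (d - 1) a)` has positive Tukey depth with respect
to the image of `μ` under `x ↦ (t 0 x, …, t (d - 1) x)`. -/
def PositiveFiniteDimDepth {E : Type*} [MeasurableSpace E] (t : ℕ → E → ℝ) (a : E)
    (μ : Measure E) : Prop :=
  ∀ d : ℕ, 1 ≤ d →
    0 < tukeyDepth d (fun i : Fin d => t i a) (μ.map fun x => fun i : Fin d => t i x)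

/-- The fourth moments of the random variables `Y k` are finite and bounded by a common multiple
of the squares of the second moments. -/
def FourthMomentBound {Ω : Type*} [MeasurableSpace Ω] (P : Measure Ω) (Y : ℕ → Ω → ℝ) : Prop :=
  ∃ c : ℝ, ∀ k, Integrable (fun ω => Y k ω ^ 4) P ∧
    ∫ ω, Y k ω ^ 4 ∂P ≤ c * (∫ ω, Y k ω ^ 2 ∂P) ^ 2

/-- `φ` is a nonnegative function on `ℝ` that is positive almost everywhere, absolutely continuous
on every compact interval, with finite Fisher information `∫ (φ')² / φ` and finite second moment
`∫ x² φ(x) dx`. As `φ` is differentiable and positive almost everywhere, the values of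
`(deriv φ x) ^ 2 / φ x` at the other points do not matter. -/
structure IsRegularDensity (φ : ℝ → ℝ) : Prop where
  nonneg : ∀ x, 0 ≤ φ x
  pos_ae : ∀ᵐ x, 0 < φ x
  absolutelyContinuous : ∀ a b : ℝ, AbsolutelyContinuousOnInterval φ a b
  fisher_lt_top : ∫⁻ x, ENNReal.ofReal ((deriv φ x) ^ 2 / φ x) < ⊤
  secondMoment_lt_top : ∫⁻ x, ENNReal.ofReal (x ^ 2 * φ x) < ⊤

/-- For some scales `0 < lam k < ∞`, the variables `Y k / lam k` are independent and all have the
law with density `φ`, where `φ` is as in `IsRegularDensity`. -/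
def ScaledIIDRegularDensity {Ω : Type*} [MeasurableSpace Ω] (P : Measure Ω) (Y : ℕ → Ω → ℝ) :
    Prop :=
  ∃ (lam : ℕ → ℝ) (φ : ℝ → ℝ), (∀ k, 0 < lam k) ∧ IsRegularDensity φ ∧
    iIndepFun (fun k ω => Y k ω / lam k) P ∧
    ∀ k, HasLaw (fun ω => Y k ω / lam k) (volume.withDensity fun x => ENNReal.ofReal (φ x)) P

/-! Necessity is Chebyshev's inequality. With coefficients `t k a / σ k ^ 2` for `k < d`, the
threshold and the variance of the combination both equal the partial sum `S`, so the depth is at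
most `1 / S`, which bounds all partial sums (`summable_of_halfSpaceDepth_pos`).

For sufficiency (`halfSpaceDepth_pos_of_summable`), cut a combination at an index `d` beyond which
the series is small. Head and tail are independent, so it is enough to bound the probability that
each exceeds its own threshold, uniformly in the coefficients. By Cauchy–Schwarz the tail threshold
is at most `ε` standard deviations of the tail. A uniform chance of exceeding that level comes from
a Paley–Zygmund bound, since a fourth-moment bound passes to independent sums; in the i.i.d. case
truncation supplies the moments. The head is controlled by the finite-dimensional depth, or, given a
density, by the positive mass on both sides of each `t k a`. -/

/-! ### Moments of independent sums and a Paley–Zygmund bound. -/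

section Moments

variable {Ω : Type*} [MeasurableSpace Ω] {P : Measure Ω}

theorem integrable_pow_of_integrable_pow_four [IsFiniteMeasure P] {Z : Ω → ℝ}
    (hm : Measurable Z) (h4 : Integrable (fun ω => Z ω ^ 4) P) {k : ℕ} (hk : k ≤ 4) :
    Integrable (fun ω => Z ω ^ k) P := by
  refine ((integrable_const (1 : ℝ)).add h4).mono' (hm.pow_const k).aestronglyMeasurable
    (ae_of_all _ fun ω => ?_)
  have h0 := abs_nonneg (Z ω)
  have h4' : |Z ω| ^ 4 = Z ω ^ 4 := by rw [← abs_pow, abs_of_nonneg (by positivity)]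
  simp only [Real.norm_eq_abs, abs_pow, Pi.add_apply, ← h4']
  rcases le_total |Z ω| 1 with h | h
  · have := pow_le_one₀ h0 h (n := k)
    have : 0 ≤ |Z ω| ^ 4 := by positivity
    linarith
  · have := pow_le_pow_right₀ h hk
    linarith

theorem integral_eq_zero_of_identDistrib_neg {Z : Ω → ℝ}
    (h : IdentDistrib Z (fun ω => -Z ω) P P) : ∫ ω, Z ω ∂P = 0 := by
  have := h.integral_eq
  rw [integral_neg] at this
  linarith

theorem integral_add_sq_of_indepFun [IsProbabilityMeasure P] {S X : Ω → ℝ} (hS : MemLp S 2 P)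
    (hX : MemLp X 2 P) (hind : S ⟂ᵢ[P] X) (hX0 : ∫ ω, X ω ∂P = 0) :
    ∫ ω, (S ω + X ω) ^ 2 ∂P = ∫ ω, S ω ^ 2 ∂P + ∫ ω, X ω ^ 2 ∂P := by
  have h1 : Integrable (fun ω => S ω * X ω) P :=
    hind.integrable_mul (hS.integrable one_le_two) (hX.integrable one_le_two)
  have h2 : ∫ ω, S ω * X ω ∂P = 0 := by
    rw [hind.integral_fun_mul_eq_mul_integral hS.1 hX.1, hX0, mul_zero]
  have e : ∀ ω, (S ω + X ω) ^ 2 = S ω ^ 2 + 2 * (S ω * X ω) + X ω ^ 2 := fun ω => by ring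
  simp_rw [e]
  have j : Integrable (fun ω => S ω ^ 2 + 2 * (S ω * X ω)) P :=
    hS.integrable_sq.add (h1.const_mul 2)
  rw [integral_add j hX.integrable_sq,
    integral_add hS.integrable_sq (h1.const_mul 2), integral_const_mul, h2]
  ring

theorem integral_add_pow_four_of_indepFun [IsProbabilityMeasure P] {S X : Ω → ℝ}
    (hS : Measurable S) (hX : Measurable X)
    (hS4 : Integrable (fun ω => S ω ^ 4) P) (hX4 : Integrable (fun ω => X ω ^ 4) P)
    (hind : S ⟂ᵢ[P] X) (hS0 : ∫ ω, S ω ∂P = 0) (hX0 : ∫ ω, X ω ∂P = 0) :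
    Integrable (fun ω => (S ω + X ω) ^ 4) P ∧
    ∫ ω, (S ω + X ω) ^ 4 ∂P = ∫ ω, S ω ^ 4 ∂P +
      6 * ((∫ ω, S ω ^ 2 ∂P) * ∫ ω, X ω ^ 2 ∂P) + ∫ ω, X ω ^ 4 ∂P := by
  have key : ∀ i j : ℕ, i ≤ 4 → j ≤ 4 → Integrable (fun ω => S ω ^ i * X ω ^ j) P ∧
      ∫ ω, S ω ^ i * X ω ^ j ∂P = (∫ ω, S ω ^ i ∂P) * ∫ ω, X ω ^ j ∂P := by
    intro i j hi hj
    have hij : (fun ω => S ω ^ i) ⟂ᵢ[P] (fun ω => X ω ^ j) :=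
      hind.comp (φ := fun x : ℝ => x ^ i) (ψ := fun x : ℝ => x ^ j)
        (by fun_prop) (by fun_prop)
    exact ⟨hij.integrable_mul (integrable_pow_of_integrable_pow_four hS hS4 hi)
      (integrable_pow_of_integrable_pow_four hX hX4 hj),
      hij.integral_fun_mul_eq_mul_integral (hS.pow_const i).aestronglyMeasurable
        (hX.pow_const j).aestronglyMeasurable⟩
  obtain ⟨i31, e31⟩ := key 3 1 (by norm_num) (by norm_num)
  obtain ⟨i22, e22⟩ := key 2 2 (by norm_num) (by norm_num)
  obtain ⟨i13, e13⟩ := key 1 3 (by norm_num) (by norm_num)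
  simp only [pow_one, hS0, hX0, mul_zero, zero_mul] at i31 e31 i13 e13
  have e : ∀ ω, (S ω + X ω) ^ 4 = S ω ^ 4 + (4 * (S ω ^ 3 * X ω) + (6 * (S ω ^ 2 * X ω ^ 2) +
      (4 * (S ω * X ω ^ 3) + X ω ^ 4))) := fun ω => by ring
  have j1 : Integrable (fun ω => 4 * (S ω * X ω ^ 3) + X ω ^ 4) P :=
    (i13.const_mul 4).add hX4
  have j2 : Integrable (fun ω => 6 * (S ω ^ 2 * X ω ^ 2) + (4 * (S ω * X ω ^ 3) + X ω ^ 4)) P :=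
    (i22.const_mul 6).add j1
  have j3 : Integrable (fun ω => 4 * (S ω ^ 3 * X ω) + (6 * (S ω ^ 2 * X ω ^ 2) +
      (4 * (S ω * X ω ^ 3) + X ω ^ 4))) P :=
    (i31.const_mul 4).add j2
  simp_rw [e]
  refine ⟨hS4.add j3, ?_⟩
  rw [integral_add hS4 j3, integral_add (i31.const_mul 4) j2, integral_add (i22.const_mul 6) j1,
    integral_add (i13.const_mul 4) hX4]
  simp only [integral_const_mul, e31, e22, e13]
  ring

theorem memLp_two_of_integrable_pow_four [IsFiniteMeasure P] {Z : Ω → ℝ}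
    (hm : Measurable Z) (h4 : Integrable (fun ω => Z ω ^ 4) P) : MemLp Z 2 P :=
  (memLp_two_iff_integrable_sq hm.aestronglyMeasurable).2
    (integrable_pow_of_integrable_pow_four hm h4 (by norm_num))

theorem ProbabilityTheory.iIndepFun.indepFun_fun_finsetSum_of_notMem {ι : Type*} {V : ι → Ω → ℝ}
    (hind : iIndepFun V P) (hm : ∀ i, Measurable (V i)) {s : Finset ι} {i : ι} (hi : i ∉ s) :
    (fun ω => ∑ j ∈ s, V j ω) ⟂ᵢ[P] V i := by
  have := hind.indepFun_finsetSum_of_notMem hm hi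
  convert this using 1
  ext ω
  simp

theorem integral_finsetSum_sq_of_iIndepFun [IsProbabilityMeasure P] {ι : Type*} {V : ι → Ω → ℝ}
    (hm : ∀ i, Measurable (V i)) (hind : iIndepFun V P) (h2 : ∀ i, MemLp (V i) 2 P)
    (h0 : ∀ i, ∫ ω, V i ω ∂P = 0) (s : Finset ι) :
    ∫ ω, (∑ i ∈ s, V i ω) ^ 2 ∂P = ∑ i ∈ s, ∫ ω, V i ω ^ 2 ∂P := by
  classical
  induction s using Finset.induction_on with
  | empty => simp
  | insert i s hi ih =>
    have hS : MemLp (fun ω => ∑ j ∈ s, V j ω) 2 P := memLp_finsetSum s fun j _ => h2 j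
    simp_rw [Finset.sum_insert hi, add_comm (V i _)]
    rw [integral_add_sq_of_indepFun hS (h2 i) (hind.indepFun_fun_finsetSum_of_notMem hm hi)
      (h0 i), ih, add_comm]

/-- Adding an independent centred term creates the cross term `6 E[S²] E[X²]`. It is absorbed by the
`2 C E[S²] E[X²]` in the expanded square precisely when `3 ≤ C`, so the constant does not grow with
the number of terms. -/
theorem integral_finsetSum_pow_four_le [IsProbabilityMeasure P] {ι : Type*} {V : ι → Ω → ℝ}
    (hm : ∀ i, Measurable (V i)) (hind : iIndepFun V P)
    (h4 : ∀ i, Integrable (fun ω => V i ω ^ 4) P) (h0 : ∀ i, ∫ ω, V i ω ∂P = 0)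
    {C : ℝ} (hC : 3 ≤ C) (hb : ∀ i, ∫ ω, V i ω ^ 4 ∂P ≤ C * (∫ ω, V i ω ^ 2 ∂P) ^ 2)
    (s : Finset ι) :
    Integrable (fun ω => (∑ i ∈ s, V i ω) ^ 4) P ∧
      ∫ ω, (∑ i ∈ s, V i ω) ^ 4 ∂P ≤ C * (∫ ω, (∑ i ∈ s, V i ω) ^ 2 ∂P) ^ 2 := by
  classical
  induction s using Finset.induction_on with
  | empty => simp
  | insert i s hi ih =>
    have h2 := fun j => memLp_two_of_integrable_pow_four (hm j) (h4 j)
    have hS : MemLp (fun ω => ∑ j ∈ s, V j ω) 2 P := memLp_finsetSum s fun j _ => h2 j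
    have hS0 : ∫ ω, ∑ j ∈ s, V j ω ∂P = 0 := by
      rw [integral_finsetSum _ fun j _ => (h2 j).integrable one_le_two]
      exact Finset.sum_eq_zero fun j _ => h0 j
    have hI := hind.indepFun_fun_finsetSum_of_notMem hm hi
    have hSm : Measurable fun ω => ∑ j ∈ s, V j ω := Finset.measurable_sum _ fun j _ => hm j
    obtain ⟨hi4, he4⟩ := integral_add_pow_four_of_indepFun hSm (hm i) ih.1 (h4 i) hI hS0 (h0 i)
    simp_rw [Finset.sum_insert hi, add_comm (V i _)]
    refine ⟨hi4, ?_⟩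
    rw [he4, integral_add_sq_of_indepFun hS (h2 i) hI (h0 i)]
    have hs : 0 ≤ ∫ ω, (∑ j ∈ s, V j ω) ^ 2 ∂P := integral_nonneg fun ω => sq_nonneg _
    have hx : 0 ≤ ∫ ω, V i ω ^ 2 ∂P := integral_nonneg fun ω => sq_nonneg _
    have := hb i
    have := ih.2
    have := mul_le_mul_of_nonneg_right hC (mul_nonneg hs hx)
    nlinarith

/-- A lower bound of Paley–Zygmund type for a symmetric random variable. -/
theorem inv_le_measureReal_ge_of_pow_four_le [IsProbabilityMeasure P] {Z : Ω → ℝ}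
    (hm : Measurable Z) (hsymm : IdentDistrib Z (fun ω => -Z ω) P P)
    (h4 : Integrable (fun ω => Z ω ^ 4) P) {C : ℝ} (hC : 1 ≤ C)
    (hb : ∫ ω, Z ω ^ 4 ∂P ≤ C * (∫ ω, Z ω ^ 2 ∂P) ^ 2) {r : ℝ}
    (hr : r ≤ √(∫ ω, Z ω ^ 2 ∂P) / 2) : 1 / (4 * C) ≤ P.real {ω | r ≤ Z ω} := by
  have h2 : Integrable (fun ω => Z ω ^ 2) P :=
    integrable_pow_of_integrable_pow_four hm h4 (by norm_num)
  have hC4 : 1 / (4 * C) ≤ 1 := by rw [div_le_one (by positivity)]; linarith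
  set m := ∫ ω, Z ω ^ 2 ∂P with hmdef
  have hm0 : 0 ≤ m := integral_nonneg fun ω => sq_nonneg _
  rcases hm0.eq_or_lt with h | hmpos
  · have hZ : ∀ᵐ ω ∂P, Z ω = 0 := by
      have := (integral_eq_zero_iff_of_nonneg (fun ω => sq_nonneg (Z ω)) h2).1 h.symm
      filter_upwards [this] with ω hω
      simpa using hω
    have hr0 : r ≤ 0 := by simpa [← h] using hr
    have : {ω | r ≤ Z ω} =ᵐ[P] Set.univ := by
      filter_upwards [hZ] with ω hω
      exact propext ⟨fun _ => trivial, fun _ => hr0.trans_eq hω.symm⟩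
    rw [measureReal_congr this]
    simpa using hC4
  set A := {ω | m / 4 ≤ Z ω ^ 2} with hA
  have hAm : MeasurableSet A := measurableSet_le measurable_const (hm.pow_const 2)
  -- Integrate `z² ≤ m/4 + z⁴/(4Cm) + Cm·1_A`: off `A` the first term suffices, on `A` the other two
  -- do by AM–GM. The first two terms integrate to at most `m/2`, so `A` has probability at least
  -- `1/(2C)`; symmetry halves this.
  have hle : m ≤ m / 4 + (1 / (4 * C * m)) * (C * m ^ 2) + (C * m) * P.real A := by
    calc m ≤ ∫ ω, (m / 4 + (1 / (4 * C * m)) * Z ω ^ 4 + A.indicator (fun _ => C * m) ω) ∂P := by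
          refine integral_mono h2 (((integrable_const _).add (h4.const_mul _)).add
            ((integrable_const _).indicator hAm)) fun ω => ?_
          have hCm : 0 < C * m := by positivity
          by_cases hω : ω ∈ A
          · have e : 1 / (4 * C * m) * Z ω ^ 4 + C * m - Z ω ^ 2
                = (Z ω ^ 2 - 2 * (C * m)) ^ 2 / (4 * (C * m)) := by
              field_simp
              ring
            have : 0 ≤ (Z ω ^ 2 - 2 * (C * m)) ^ 2 / (4 * (C * m)) := by positivity
            simp only [Set.indicator_of_mem hω]
            linarith
          · have h' : Z ω ^ 2 < m / 4 := by simpa [hA] using hω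
            have : 0 ≤ 1 / (4 * C * m) * Z ω ^ 4 := by positivity
            simp only [Set.indicator_of_notMem hω]
            linarith
      _ = m / 4 + (1 / (4 * C * m)) * ∫ ω, Z ω ^ 4 ∂P + (C * m) * P.real A := by
          have j : Integrable (fun ω => m / 4 + 1 / (4 * C * m) * Z ω ^ 4) P :=
            (integrable_const _).add (h4.const_mul _)
          rw [integral_add j
            ((integrable_const _).indicator hAm), integral_add (integrable_const _)
            (h4.const_mul _), integral_indicator_const _ hAm, integral_const_mul]
          simp [mul_comm]
      _ ≤ _ := by gcongr
  have hsub : A ⊆ {ω | r ≤ Z ω} ∪ {ω | r ≤ -Z ω} := by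
    intro ω hω
    have h1 : √m / 2 ≤ |Z ω| := by
      have : √(m / 4) ≤ √(Z ω ^ 2) := Real.sqrt_le_sqrt hω
      rw [Real.sqrt_sq_eq_abs, Real.sqrt_div hm0] at this
      rwa [show (4 : ℝ) = 2 ^ 2 by norm_num, Real.sqrt_sq (by norm_num)] at this
    rcases le_abs.1 (hr.trans h1) with h | h
    · exact Or.inl h
    · exact Or.inr h
  have heq : P.real {ω | r ≤ -Z ω} = P.real {ω | r ≤ Z ω} :=
    congrArg ENNReal.toReal (hsymm.measure_mem_eq (s := Set.Ici r) measurableSet_Ici).symm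
  have hPA : P.real A ≤ 2 * P.real {ω | r ≤ Z ω} := by
    have := (measureReal_mono hsub).trans (measureReal_union_le (μ := P) _ _)
    linarith
  have e : (1 / (4 * C * m)) * (C * m ^ 2) = m / 4 := by field_simp
  rw [e] at hle
  have h3 : 1 / 2 ≤ C * P.real A := by
    have : m * (1 / 2) ≤ m * (C * P.real A) := by linarith
    exact le_of_mul_le_mul_left this hmpos
  rw [div_le_iff₀ (by positivity)]
  have := mul_le_mul_of_nonneg_left hPA (by positivity : 0 ≤ C)
  linarith

end Moments

/-! ### Uniform lower bounds for weighted sums of independent symmetric variables. -/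

section Tail

variable {Ω : Type*} [MeasurableSpace Ω] {P : Measure Ω}

theorem identDistrib_finsetSum_of_iIndepFun {ι : Type*} [Countable ι] {Y Y' : ι → Ω → ℝ}
    (hY : iIndepFun Y P) (hY' : iIndepFun Y' P) (h : ∀ i, IdentDistrib (Y i) (Y' i) P P)
    (s : Finset ι) :
    IdentDistrib (fun ω => ∑ i ∈ s, Y i ω) (fun ω => ∑ i ∈ s, Y' i ω) P P :=
  (IdentDistrib.pi h hY hY').comp (u := fun x : ι → ℝ => ∑ i ∈ s, x i) (by fun_prop)

theorem identDistrib_neg_finsetSum_of_iIndepFun {ι : Type*} [Countable ι] {Y : ι → Ω → ℝ}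
    (hY : iIndepFun Y P) (h : ∀ i, IdentDistrib (Y i) (fun ω => -Y i ω) P P) (s : Finset ι) :
    IdentDistrib (fun ω => ∑ i ∈ s, Y i ω) (fun ω => -∑ i ∈ s, Y i ω) P P := by
  have := identDistrib_finsetSum_of_iIndepFun hY
    (hY.comp (fun _ x => -x) fun _ => measurable_neg) h s
  simpa [Function.comp_def] using this

/-- The identity on `[-1, 1]` and zero elsewhere. -/
noncomputable def unitTruncation (y : ℝ) : ℝ := if |y| ≤ 1 then y else 0

/-- The identity on `[-1, 1]` and the reflection elsewhere. -/
noncomputable def reflectOutsideUnit (y : ℝ) : ℝ := if |y| ≤ 1 then y else -y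

theorem measurable_unitTruncation : Measurable unitTruncation :=
  Measurable.ite (measurableSet_le measurable_id.abs measurable_const) measurable_id
    measurable_const

theorem measurable_reflectOutsideUnit : Measurable reflectOutsideUnit :=
  Measurable.ite (measurableSet_le measurable_id.abs measurable_const) measurable_id
    measurable_neg

theorem unitTruncation_neg (y : ℝ) : unitTruncation (-y) = -unitTruncation y := by
  unfold unitTruncation
  split_ifs <;> simp_all

theorem add_reflectOutsideUnit (y : ℝ) : y + reflectOutsideUnit y = 2 * unitTruncation y := by
  unfold unitTruncation reflectOutsideUnit
  split_ifs <;> ring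

theorem abs_unitTruncation_le_one (y : ℝ) : |unitTruncation y| ≤ 1 := by
  unfold unitTruncation
  split_ifs with h
  · exact h
  · simp

/-- The sign changes only outside `[-1, 1]`, a symmetric set on which the law is invariant under `y
↦ -y`. -/
theorem identDistrib_reflectOutsideUnit [IsFiniteMeasure P] {Z : Ω → ℝ} (hm : Measurable Z)
    (h : IdentDistrib Z (fun ω => -Z ω) P P) :
    IdentDistrib Z (fun ω => reflectOutsideUnit (Z ω)) P P := by
  have hgm : Measurable fun ω => reflectOutsideUnit (Z ω) := measurable_reflectOutsideUnit.comp hm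
  refine ⟨hm.aemeasurable, hgm.aemeasurable, ?_⟩
  ext B hB
  rw [Measure.map_apply hm hB, Measure.map_apply hgm hB]
  have hD : MeasurableSet {y : ℝ | |y| ≤ 1} := measurableSet_le measurable_id.abs measurable_const
  rw [← measure_inter_add_sdiff _ (hm hD),
    ← measure_inter_add_sdiff ((fun ω => reflectOutsideUnit (Z ω)) ⁻¹' B) (hm hD)]
  congr 1
  · congr 1
    ext ω
    simp only [Set.mem_inter_iff, Set.mem_preimage, Set.mem_ofPred_eq, and_congr_left_iff]
    intro hω
    simp [reflectOutsideUnit, hω]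
  · have e := h.measure_mem_eq (hB.diff hD)
    have e1 : (fun ω => -Z ω) ⁻¹' (B \ {y : ℝ | |y| ≤ 1}) =
        (fun ω => reflectOutsideUnit (Z ω)) ⁻¹' B \ Z ⁻¹' {y : ℝ | |y| ≤ 1} := by
      ext ω
      simp only [Set.mem_sdiff, Set.mem_preimage, Set.mem_ofPred_eq, and_congr_left_iff, abs_neg]
      intro hω
      simp [reflectOutsideUnit, hω]
    rw [← e1, ← e]
    rfl

theorem exists_uniform_lower_bound_of_fourthMomentBound [IsProbabilityMeasure P]
    {Y : ℕ → Ω → ℝ} (hm : ∀ k, Measurable (Y k)) (hind : iIndepFun Y P)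
    (hsymm : ∀ k, IdentDistrib (Y k) (fun ω => -Y k ω) P P) (h4 : FourthMomentBound P Y) :
    ∃ δ > 0, ∃ ε > 0, ∀ (s : Finset ℕ) (c : ℕ → ℝ) (r : ℝ),
      r ≤ ε * √(∑ k ∈ s, c k ^ 2 * ∫ ω, Y k ω ^ 2 ∂P) →
        δ ≤ P.real {ω | r ≤ ∑ k ∈ s, c k * Y k ω} := by
  obtain ⟨C₀, hC₀⟩ := h4
  -- At least `3` so that the fourth-moment bound is stable under sums.
  set C := max C₀ 3
  have hC : 3 ≤ C := le_max_right _ _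
  refine ⟨1 / (4 * C), by positivity, 1 / 2, by norm_num, fun s c r hr => ?_⟩
  have hVm : ∀ k, Measurable fun ω => c k * Y k ω := fun k => (hm k).const_mul _
  have hVind : iIndepFun (fun k ω => c k * Y k ω) P :=
    hind.comp (fun k x => c k * x) fun k => measurable_const_mul _
  have hV4 : ∀ k, Integrable (fun ω => (c k * Y k ω) ^ 4) P := fun k => by
    simpa only [mul_pow] using (hC₀ k).1.const_mul (c k ^ 4)
  have hVsymm : ∀ k, IdentDistrib (fun ω => c k * Y k ω) (fun ω => -(c k * Y k ω)) P P :=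
    fun k => by simpa using (hsymm k).const_mul (c k)
  have hV0 := fun k => integral_eq_zero_of_identDistrib_neg (hVsymm k)
  have hVb : ∀ k, ∫ ω, (c k * Y k ω) ^ 4 ∂P ≤ C * (∫ ω, (c k * Y k ω) ^ 2 ∂P) ^ 2 := fun k => by
    simp only [mul_pow, integral_const_mul]
    calc c k ^ 4 * ∫ ω, Y k ω ^ 4 ∂P ≤ c k ^ 4 * (C * (∫ ω, Y k ω ^ 2 ∂P) ^ 2) := by
          gcongr
          exact (hC₀ k).2.trans (by gcongr; exact le_max_left _ _)
      _ = _ := by ring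
  obtain ⟨i4, b4⟩ := integral_finsetSum_pow_four_le hVm hVind hV4 hV0 hC hVb s
  refine inv_le_measureReal_ge_of_pow_four_le (Finset.measurable_sum _ fun k _ => hVm k)
    (identDistrib_neg_finsetSum_of_iIndepFun hVind hVsymm s) i4 (by linarith) b4 ?_
  rw [integral_finsetSum_sq_of_iIndepFun hVm hVind
    (fun k => memLp_two_of_integrable_pow_four (hVm k) (hV4 k)) hV0]
  simp only [mul_pow, integral_const_mul]
  linarith

/-- No moments of `W` are needed: the fourth-moment case applies to the truncations, and twice the
truncated sum is the original sum plus its reflected copy. When the truncated sum reaches `r`, one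
of these two does; they have the same law, so only a factor `2` is lost. -/
theorem exists_uniform_lower_bound_of_identDistrib [IsProbabilityMeasure P]
    {W : ℕ → Ω → ℝ} (hm : ∀ k, Measurable (W k)) (hind : iIndepFun W P)
    (hsymm : ∀ k, IdentDistrib (W k) (fun ω => -W k ω) P P)
    (hid : ∀ k, IdentDistrib (W k) (W 0) P P) (hpos : 0 < P {ω | W 0 ω ∈ Set.Ioc 0 1}) :
    ∃ δ > 0, ∃ ε > 0, ∀ (s : Finset ℕ) (c : ℕ → ℝ) (r : ℝ),
      r ≤ ε * √(∑ k ∈ s, c k ^ 2) → δ ≤ P.real {ω | r ≤ ∑ k ∈ s, c k * W k ω} := by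
  have hTm := measurable_unitTruncation
  have hVm : ∀ k, Measurable fun ω => unitTruncation (W k ω) := fun k => hTm.comp (hm k)
  have hVind : iIndepFun (fun k ω => unitTruncation (W k ω)) P :=
    hind.comp (fun _ => unitTruncation) fun _ => hTm
  have hVsymm : ∀ k, IdentDistrib (fun ω => unitTruncation (W k ω))
      (fun ω => -unitTruncation (W k ω)) P P := fun k => by
    simpa only [Function.comp_def, unitTruncation_neg] using (hsymm k).comp hTm
  have hbd : ∀ n k, Integrable (fun ω => unitTruncation (W k ω) ^ n) P := fun n k =>
    Integrable.of_bound ((hVm k).pow_const n).aestronglyMeasurable 1 (ae_of_all _ fun ω => by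
      simpa using pow_le_one₀ (abs_nonneg _) (abs_unitTruncation_le_one (W k ω)))
  set v := ∫ ω, unitTruncation (W 0 ω) ^ 2 ∂P with hv
  have hvk : ∀ k, ∫ ω, unitTruncation (W k ω) ^ 2 ∂P = v := fun k =>
    ((hid k).comp (hTm.pow_const 2)).integral_eq
  have hv0 : 0 < v := by
    rw [hv, integral_pos_iff_support_of_nonneg (fun ω => sq_nonneg _) (hbd 2 0)]
    refine hpos.trans_le (measure_mono fun ω hω => ?_)
    have h1 : |W 0 ω| ≤ 1 := abs_le.2 ⟨by linarith [hω.1], hω.2⟩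
    simp [unitTruncation, h1, hω.1.ne']
  have h4 : FourthMomentBound P fun k ω => unitTruncation (W k ω) := by
    -- As truncations are bounded by `1`, their fourth moment is at most `v = (1 / v) * v ^ 2`.
    refine ⟨1 / v, fun k => ⟨hbd 4 k, ?_⟩⟩
    rw [hvk, show 1 / v * v ^ 2 = v by field_simp, ← hvk k]
    refine integral_mono (hbd 4 k) (hbd 2 k) fun ω => ?_
    have h1 : unitTruncation (W k ω) ^ 2 ≤ 1 := by
      rw [← sq_abs]
      exact pow_le_one₀ (abs_nonneg _) (abs_unitTruncation_le_one _)
    nlinarith [sq_nonneg (unitTruncation (W k ω))]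
  obtain ⟨δ, hδ, ε, hε, h⟩ := exists_uniform_lower_bound_of_fourthMomentBound hVm hVind hVsymm h4
  refine ⟨δ / 2, by positivity, ε * √v, by positivity, fun s c r hr => ?_⟩
  have hA := h s c r (by
    simp only [hvk, ← Finset.sum_mul]
    rw [mul_comm (∑ k ∈ s, c k ^ 2), Real.sqrt_mul hv0.le, ← mul_assoc]
    exact hr)
  have hrefl : IdentDistrib (fun ω => ∑ k ∈ s, c k * W k ω)
      (fun ω => ∑ k ∈ s, c k * reflectOutsideUnit (W k ω)) P P :=
    identDistrib_finsetSum_of_iIndepFun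
      (hind.comp (fun k x => c k * x) fun k => measurable_const_mul _)
      (hind.comp (fun k x => c k * reflectOutsideUnit x) fun k =>
        measurable_reflectOutsideUnit.const_mul _)
      (fun k => (identDistrib_reflectOutsideUnit (hm k) (hsymm k)).const_mul (c k)) s
  have heq : P.real {ω | r ≤ ∑ k ∈ s, c k * W k ω} =
      P.real {ω | r ≤ ∑ k ∈ s, c k * reflectOutsideUnit (W k ω)} :=
    congrArg ENNReal.toReal (hrefl.measure_mem_eq (s := Set.Ici r) measurableSet_Ici)
  have hsub : {ω | r ≤ ∑ k ∈ s, c k * unitTruncation (W k ω)} ⊆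
      {ω | r ≤ ∑ k ∈ s, c k * W k ω} ∪ {ω | r ≤ ∑ k ∈ s, c k * reflectOutsideUnit (W k ω)} := by
    intro ω hω
    by_contra! hcon
    simp only [Set.mem_union, Set.mem_ofPred_eq, not_or, not_le] at hcon hω
    have : ∑ k ∈ s, c k * W k ω + ∑ k ∈ s, c k * reflectOutsideUnit (W k ω) =
        2 * ∑ k ∈ s, c k * unitTruncation (W k ω) := by
      rw [← Finset.sum_add_distrib, Finset.mul_sum]
      refine Finset.sum_congr rfl fun k _ => ?_
      rw [← mul_add, add_reflectOutsideUnit]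
      ring
    linarith [hcon.1, hcon.2]
  have := (measureReal_mono hsub).trans (measureReal_union_le (μ := P) _ _)
  linarith

end Tail

/-! ### Depth over finite combinations: head bounds, necessity and sufficiency. -/

section Depth

variable {Ω : Type*} [MeasurableSpace Ω] {P : Measure Ω} {B : Type*} [MeasurableSpace B]
  {X : Ω → B} {t : ℕ → B → ℝ}

theorem mem_finiteCombinations_iff {E : Type*} {t : ℕ → E → ℝ} {f : E → ℝ} :
    f ∈ finiteCombinations t ↔
      ∃ (s : Finset ℕ) (c : ℕ → ℝ), f = fun x => ∑ k ∈ s, c k * t k x := by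
  rw [finiteCombinations, SetLike.mem_coe]
  constructor
  · intro hf
    obtain ⟨c, rfl⟩ := Finsupp.mem_span_range_iff_exists_finsupp.1 hf
    refine ⟨c.support, c, ?_⟩
    ext x
    simp [Finsupp.sum]
  · rintro ⟨s, c, rfl⟩
    have e : (fun x => ∑ k ∈ s, c k * t k x) = ∑ k ∈ s, c k • t k := by
      ext x
      simp
    rw [e]
    exact Submodule.sum_mem _ fun k _ =>
      Submodule.smul_mem _ _ (Submodule.subset_span (Set.mem_range_self k))

theorem map_halfSpace_eq (hX : Measurable X) (ht : ∀ k, Measurable (t k)) (s : Finset ℕ)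
    (c : ℕ → ℝ) (r : ℝ) :
    P.map X {x | r ≤ ∑ k ∈ s, c k * t k x} = P {ω | r ≤ ∑ k ∈ s, c k * t k (X ω)} := by
  rw [Measure.map_apply hX (measurableSet_le measurable_const
    (Finset.measurable_sum _ fun k _ => (ht k).const_mul _))]
  rfl

theorem exists_lower_bound_range_of_positiveFiniteDimDepth [IsProbabilityMeasure P]
    (hX : Measurable X) (ht : ∀ k, Measurable (t k)) {a : B}
    (h : PositiveFiniteDimDepth t a (P.map X)) (d : ℕ) :
    ∃ δ > 0, ∀ c : ℕ → ℝ, δ ≤ P.real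
      {ω | ∑ k ∈ Finset.range d, c k * t k a ≤ ∑ k ∈ Finset.range d, c k * t k (X ω)} := by
  rcases Nat.eq_zero_or_pos d with rfl | hd
  · exact ⟨1, one_pos, fun c => by simp⟩
  set D := tukeyDepth d (fun i : Fin d => t i a) ((P.map X).map fun x => fun i : Fin d => t i x)
    with hD
  have key : ∀ c : ℕ → ℝ, D ≤ P
      {ω | ∑ k ∈ Finset.range d, c k * t k a ≤ ∑ k ∈ Finset.range d, c k * t k (X ω)} := by
    intro c
    let l : (Fin d → ℝ) →ₗ[ℝ] ℝ := ∑ i : Fin d, c i • LinearMap.proj i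
    have hl : ∀ x, l x = ∑ i : Fin d, c i * x i := fun x => by simp [l]
    refine (iInf₂_le (l : (Fin d → ℝ) → ℝ) ⟨l, rfl⟩).trans ?_
    have hlm : Measurable l := by
      have : (l : (Fin d → ℝ) → ℝ) = fun x => ∑ i : Fin d, c i * x i := funext hl
      rw [this]
      fun_prop
    rw [Measure.map_apply (measurable_pi_lambda _ fun i : Fin d => ht i)
      (measurableSet_le measurable_const hlm), ← map_halfSpace_eq hX ht]
    refine measure_mono fun x hx => ?_
    simp only [Set.mem_preimage, Set.mem_ofPred_eq, hl] at hx
    simpa [Finset.sum_range] using hx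
  have hDtop : D ≠ ⊤ := ((key 0).trans prob_le_one).trans_lt ENNReal.one_lt_top |>.ne
  exact ⟨D.toReal, ENNReal.toReal_pos (h d hd).ne' hDtop, fun c =>
    ENNReal.toReal_mono (measure_ne_top _ _) (key c)⟩

/-- The signs of `c` select an orthant with corner `b` on which the inequality holds term by term.
By independence its mass is a product, bounded below by taking the smaller side in each coordinate.
-/
theorem exists_lower_bound_range_of_iIndepFun [IsProbabilityMeasure P] {Y : ℕ → Ω → ℝ}
    (hind : iIndepFun Y P) {b : ℕ → ℝ}
    (hle : ∀ k, 0 < P.real (Y k ⁻¹' Set.Iic (b k))) (hge : ∀ k, 0 < P.real (Y k ⁻¹' Set.Ici (b k)))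
    (d : ℕ) :
    ∃ δ > 0, ∀ c : ℕ → ℝ, δ ≤ P.real
      {ω | ∑ k ∈ Finset.range d, c k * b k ≤ ∑ k ∈ Finset.range d, c k * Y k ω} := by
  refine ⟨∏ k ∈ Finset.range d,
    min (P.real (Y k ⁻¹' Set.Iic (b k))) (P.real (Y k ⁻¹' Set.Ici (b k))),
    Finset.prod_pos fun k _ => lt_min (hle k) (hge k), fun c => ?_⟩
  let S : ℕ → Set ℝ := fun k => if 0 ≤ c k then Set.Ici (b k) else Set.Iic (b k)
  have hS : ∀ k, MeasurableSet (S k) := fun k => by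
    simp only [S]
    split_ifs
    exacts [measurableSet_Ici, measurableSet_Iic]
  have hprod : P.real (⋂ k ∈ Finset.range d, Y k ⁻¹' S k) =
      ∏ k ∈ Finset.range d, P.real (Y k ⁻¹' S k) := by
    rw [measureReal_def, hind.measure_inter_preimage_eq_mul _ fun k _ => hS k,
      ENNReal.toReal_prod]
    rfl
  calc _ ≤ ∏ k ∈ Finset.range d, P.real (Y k ⁻¹' S k) := by
        refine Finset.prod_le_prod (fun k _ => (lt_min (hle k) (hge k)).le) fun k _ => ?_
        simp only [S]
        split_ifs
        exacts [min_le_right _ _, min_le_left _ _]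
    _ = _ := hprod.symm
    _ ≤ _ := by
        refine measureReal_mono fun ω hω => ?_
        rw [Set.mem_ofPred_eq]
        refine Finset.sum_le_sum fun k hk => ?_
        have h1 : Y k ω ∈ S k := Set.mem_iInter₂.1 hω k hk
        by_cases hc : 0 ≤ c k
        · simp only [S, hc, if_true] at h1
          exact mul_le_mul_of_nonneg_left h1 hc
        · simp only [S, hc, if_false] at h1
          exact mul_le_mul_of_nonpos_left h1 (not_le.1 hc).le

theorem indepFun_sum_const_mul_of_disjoint {Y : ℕ → Ω → ℝ} (hm : ∀ k, Measurable (Y k))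
    (hind : iIndepFun Y P) {s u : Finset ℕ} (hsu : Disjoint s u) (c : ℕ → ℝ) :
    (fun ω => ∑ k ∈ s, c k * Y k ω) ⟂ᵢ[P] (fun ω => ∑ k ∈ u, c k * Y k ω) := by
  have := (hind.indepFun_finset s u hsu hm).comp
    (φ := fun x : s → ℝ => ∑ i : s, c i * x i) (ψ := fun x : u → ℝ => ∑ i : u, c i * x i)
    (by fun_prop) (by fun_prop)
  have e : ∀ (v : Finset ℕ), (fun ω => ∑ k ∈ v, c k * Y k ω) =
      (fun x : v → ℝ => ∑ i : v, c i * x i) ∘ fun ω (i : v) => Y i ω := fun v => by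
    ext ω
    exact (Finset.sum_coe_sort v fun k => c k * Y k ω).symm
  rw [e s, e u]
  exact this

theorem summable_of_halfSpaceDepth_pos [IsProbabilityMeasure P] (hX : Measurable X)
    (ht : ∀ k, Measurable (t k)) (hind : iIndepFun (fun k ω => t k (X ω)) P)
    (h2 : ∀ k, MemLp (fun ω => t k (X ω)) 2 P) (h0 : ∀ k, ∫ ω, t k (X ω) ∂P = 0)
    {σ : ℕ → ℝ} (hσ : ∀ k, 0 < σ k) (hvar : ∀ k, ∫ ω, t k (X ω) ^ 2 ∂P = σ k ^ 2) {a : B}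
    (h : 0 < halfSpaceDepth (finiteCombinations t) a (P.map X)) :
    Summable fun k => t k a ^ 2 / σ k ^ 2 := by
  set D := halfSpaceDepth (finiteCombinations t) a (P.map X) with hD
  have : IsProbabilityMeasure (P.map X) := Measure.isProbabilityMeasure_map hX.aemeasurable
  have hDtop : D ≠ ⊤ := by
    refine (lt_of_le_of_lt (iInf₂_le 0 ?_) (measure_lt_top (P.map X) _)).ne
    exact Submodule.zero_mem _
  have hDpos := ENNReal.toReal_pos h.ne' hDtop
  refine summable_of_sum_range_le (c := 1 / D.toReal) (fun k => by positivity) fun d => ?_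
  set S := ∑ k ∈ Finset.range d, t k a ^ 2 / σ k ^ 2 with hS
  have hS0 : 0 ≤ S := Finset.sum_nonneg fun k _ => by positivity
  rcases hS0.eq_or_lt with h' | hSpos
  · rw [← h']
    positivity
  -- The equality case of Cauchy–Schwarz: it maximises threshold over standard deviation.
  let c : ℕ → ℝ := fun k => t k a / σ k ^ 2
  have hca : ∑ k ∈ Finset.range d, c k * t k a = S :=
    Finset.sum_congr rfl fun k _ => by simp only [c]; ring
  have hZ2 : ∀ k, MemLp (fun ω => c k * t k (X ω)) 2 P := fun k => (h2 k).const_mul _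
  have hZ0 : ∀ k, ∫ ω, c k * t k (X ω) ∂P = 0 := fun k => by
    rw [integral_const_mul, h0, mul_zero]
  have hZL : MemLp (fun ω => ∑ k ∈ Finset.range d, c k * t k (X ω)) 2 P :=
    memLp_finsetSum _ fun k _ => hZ2 k
  have hmean : ∫ ω, ∑ k ∈ Finset.range d, c k * t k (X ω) ∂P = 0 := by
    rw [integral_finsetSum _ fun k _ => (hZ2 k).integrable one_le_two]
    exact Finset.sum_eq_zero fun k _ => hZ0 k
  have hvarZ : variance (fun ω => ∑ k ∈ Finset.range d, c k * t k (X ω)) P = S := by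
    rw [variance_of_integral_eq_zero hZL.1.aemeasurable hmean,
      integral_finsetSum_sq_of_iIndepFun (V := fun k ω => c k * t k (X ω))
        (fun k => ((ht k).comp hX).const_mul _)
        (hind.comp (fun k x => c k * x) fun k => measurable_const_mul _) hZ2 hZ0]
    refine Finset.sum_congr rfl fun k _ => ?_
    simp only [mul_pow, integral_const_mul, hvar, c]
    have := (hσ k).ne'
    field_simp
  have hle : D ≤ ENNReal.ofReal (S / S ^ 2) := by
    calc D ≤ P.map X {x | ∑ k ∈ Finset.range d, c k * t k a
            ≤ ∑ k ∈ Finset.range d, c k * t k x} :=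
          iInf₂_le _ (mem_finiteCombinations_iff.2 ⟨_, c, rfl⟩)
      _ = P {ω | S ≤ ∑ k ∈ Finset.range d, c k * t k (X ω)} := by
          rw [map_halfSpace_eq hX ht, hca]
      _ ≤ P {ω | S ≤ |∑ k ∈ Finset.range d, c k * t k (X ω) -
            ∫ ω, ∑ k ∈ Finset.range d, c k * t k (X ω) ∂P|} := by
          refine measure_mono fun ω hω => ?_
          rw [Set.mem_ofPred_eq, hmean, sub_zero]
          exact le_trans hω (le_abs_self _)
      _ ≤ _ := by
          rw [← hvarZ]
          exact meas_ge_le_variance_div_sq hZL (hvarZ ▸ hSpos)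
  have h3 : D.toReal ≤ S / S ^ 2 :=
    ENNReal.toReal_le_of_le_ofReal (by positivity) hle
  rw [show S / S ^ 2 = 1 / S by field_simp] at h3
  exact (le_one_div hDpos hSpos).1 h3

theorem halfSpaceDepth_pos_of_summable [IsProbabilityMeasure P] (hX : Measurable X)
    (ht : ∀ k, Measurable (t k)) (hind : iIndepFun (fun k ω => t k (X ω)) P)
    {σ : ℕ → ℝ} (hσ : ∀ k, 0 < σ k) {a : B}
    (hhead : ∀ d, ∃ δ > 0, ∀ c : ℕ → ℝ, δ ≤ P.real
      {ω | ∑ k ∈ Finset.range d, c k * t k a ≤ ∑ k ∈ Finset.range d, c k * t k (X ω)})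
    (htail : ∃ δ > 0, ∃ ε > 0, ∀ (s : Finset ℕ) (c : ℕ → ℝ) (r : ℝ),
      r ≤ ε * √(∑ k ∈ s, c k ^ 2 * σ k ^ 2) →
        δ ≤ P.real {ω | r ≤ ∑ k ∈ s, c k * t k (X ω)})
    (hsum : Summable fun k => t k a ^ 2 / σ k ^ 2) :
    0 < halfSpaceDepth (finiteCombinations t) a (P.map X) := by
  classical
  obtain ⟨δ₂, hδ₂, ε, hε, htail⟩ := htail
  obtain ⟨F, hF⟩ := summable_iff_vanishing_norm.1 hsum (ε ^ 2) (by positivity)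
  obtain ⟨d, hd⟩ := F.exists_nat_subset_range
  obtain ⟨δ₁, hδ₁, hhead⟩ := hhead d
  refine lt_of_lt_of_le (ENNReal.ofReal_pos.2 (mul_pos hδ₁ hδ₂)) (le_iInf₂ fun f hf => ?_)
  obtain ⟨s₀, c₀, rfl⟩ := mem_finiteCombinations_iff.1 hf
  -- Extension by zero, since the head bound runs over all of `range d` while `s₀` may miss some
  -- indices.
  set c : ℕ → ℝ := fun k => if k ∈ s₀ then c₀ k else 0 with hc
  set u := s₀ \ Finset.range d
  have hsplit : ∀ y : ℕ → ℝ, ∑ k ∈ s₀, c₀ k * y k =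
      ∑ k ∈ Finset.range d, c k * y k + ∑ k ∈ u, c k * y k := by
    intro y
    rw [← Finset.sum_union Finset.disjoint_sdiff]
    have hsub : s₀ ⊆ Finset.range d ∪ u := fun k hk => by
      by_cases h : k ∈ Finset.range d <;> simp_all [u]
    rw [← Finset.sum_subset hsub fun k _ hk => by simp [hc, hk]]
    exact Finset.sum_congr rfl fun k hk => by simp [hc, hk]
  have hb := htail u c (∑ k ∈ u, c k * t k a) (by
    have hFu := hF u (Finset.disjoint_of_subset_right hd Finset.sdiff_disjoint)
    rw [Real.norm_of_nonneg (Finset.sum_nonneg fun k _ => by positivity)] at hFu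
    have hsq : √(∑ k ∈ u, t k a ^ 2 / σ k ^ 2) ≤ ε :=
      Real.sqrt_le_iff.2 ⟨hε.le, hFu.le⟩
    have cs := Real.sum_mul_le_sqrt_mul_sqrt u (fun k => c k * σ k) fun k => t k a / σ k
    calc ∑ k ∈ u, c k * t k a = ∑ k ∈ u, c k * σ k * (t k a / σ k) :=
          Finset.sum_congr rfl fun k _ => by
            have := (hσ k).ne'
            field_simp
      _ ≤ _ := cs
      _ ≤ √(∑ k ∈ u, c k ^ 2 * σ k ^ 2) * ε := by
          simp only [mul_pow, div_pow]
          gcongr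
      _ = _ := mul_comm _ _)
  have ha := hhead c
  have hI := indepFun_sum_const_mul_of_disjoint (fun k => (ht k).comp hX) hind
    (s := Finset.range d) (u := u) Finset.disjoint_sdiff c
  rw [map_halfSpace_eq hX ht]
  have hmul := hI.measure_inter_preimage_eq_mul (Set.Ici (∑ k ∈ Finset.range d, c k * t k a))
    (Set.Ici (∑ k ∈ u, c k * t k a)) measurableSet_Ici measurableSet_Ici
  calc ENNReal.ofReal (δ₁ * δ₂) = ENNReal.ofReal δ₁ * ENNReal.ofReal δ₂ :=
        ENNReal.ofReal_mul hδ₁.le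
    _ ≤ _ := mul_le_mul' (ENNReal.ofReal_le_of_le_toReal ha) (ENNReal.ofReal_le_of_le_toReal hb)
    _ = _ := hmul.symm
    _ ≤ _ := by
        refine measure_mono fun ω hω => ?_
        rw [Set.mem_ofPred_eq, hsplit]
        beta_reduce
        rw [hsplit]
        exact add_le_add hω.1 hω.2

/-! ### Head and tail bounds in the scaled i.i.d. case. -/

theorem IsRegularDensity.continuous {φ : ℝ → ℝ} (h : IsRegularDensity φ) : Continuous φ := by
  refine continuous_iff_continuousAt.2 fun x => ?_
  have := (h.absolutelyContinuous (x - 1) (x + 1)).continuousOn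
  rw [Set.uIcc_of_le (by linarith)] at this
  exact this.continuousAt (Icc_mem_nhds (by linarith) (by linarith))

theorem IsRegularDensity.withDensity_pos {φ : ℝ → ℝ} (h : IsRegularDensity φ) {A : Set ℝ}
    (hA : volume A ≠ 0) : 0 < (volume.withDensity fun x => ENNReal.ofReal (φ x)) A := by
  have hac : volume ≪ volume.withDensity fun x => ENNReal.ofReal (φ x) :=
    withDensity_absolutelyContinuous' h.continuous.measurable.ennreal_ofReal.aemeasurable
      (h.pos_ae.mono fun x hx => by simpa using hx)
  exact pos_iff_ne_zero.2 fun h0 => hA (hac h0)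

theorem exists_lower_bound_range_of_scaledIIDRegularDensity [IsProbabilityMeasure P]
    {Y : ℕ → Ω → ℝ} (hind : iIndepFun Y P) (h : ScaledIIDRegularDensity P Y) (b : ℕ → ℝ) (d : ℕ) :
    ∃ δ > 0, ∀ c : ℕ → ℝ, δ ≤ P.real
      {ω | ∑ k ∈ Finset.range d, c k * b k ≤ ∑ k ∈ Finset.range d, c k * Y k ω} := by
  obtain ⟨lam, φ, hlam, hφ, -, hlaw⟩ := h
  have key : ∀ k (A : Set ℝ), MeasurableSet A → volume A ≠ 0 →
      0 < P.real {ω | Y k ω / lam k ∈ A} := fun k A hA hA0 => by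
    refine ENNReal.toReal_pos ?_ (measure_ne_top _ _)
    rw [(hlaw k).measure_eq (p := (· ∈ A)) hA]
    exact (hφ.withDensity_pos hA0).ne'
  refine exists_lower_bound_range_of_iIndepFun hind (fun k => ?_) (fun k => ?_) d
  · convert key k (Set.Iic (b k / lam k)) measurableSet_Iic (by simp) using 2
    ext ω
    simp [div_le_div_iff_of_pos_right (hlam k)]
  · convert key k (Set.Ici (b k / lam k)) measurableSet_Ici (by simp) using 2
    ext ω
    simp [div_le_div_iff_of_pos_right (hlam k)]

theorem exists_uniform_lower_bound_of_scaledIIDRegularDensity [IsProbabilityMeasure P]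
    {Y : ℕ → Ω → ℝ} (hm : ∀ k, Measurable (Y k))
    (hsymm : ∀ k, IdentDistrib (Y k) (fun ω => -Y k ω) P P) (h : ScaledIIDRegularDensity P Y) :
    ∃ δ > 0, ∃ ε > 0, ∀ (s : Finset ℕ) (c : ℕ → ℝ) (r : ℝ),
      r ≤ ε * √(∑ k ∈ s, c k ^ 2 * ∫ ω, Y k ω ^ 2 ∂P) →
        δ ≤ P.real {ω | r ≤ ∑ k ∈ s, c k * Y k ω} := by
  obtain ⟨lam, φ, hlam, hφ, hind, hlaw⟩ := h
  have hid : ∀ k, IdentDistrib (fun ω => Y k ω / lam k) (fun ω => Y 0 ω / lam 0) P P :=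
    fun k => (hlaw k).identDistrib (hlaw 0)
  have hYW : ∀ k ω, Y k ω = lam k * (Y k ω / lam k) := fun k ω => by
    have := (hlam k).ne'
    field_simp
  obtain ⟨δ, hδ, ε, hε, h⟩ := exists_uniform_lower_bound_of_identDistrib
    (fun k => (hm k).div_const (lam k)) hind
    (fun k => by simpa only [neg_div] using (hsymm k).div_const (lam k)) hid (by
      rw [(hlaw 0).measure_eq (p := (· ∈ Set.Ioc (0 : ℝ) 1)) measurableSet_Ioc]
      exact hφ.withDensity_pos (A := Set.Ioc 0 1) (by rw [Real.volume_Ioc]; simp))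
  set τ := ∫ ω, (Y 0 ω / lam 0) ^ 2 ∂P with hτ
  have hτ0 : 0 ≤ τ := integral_nonneg fun ω => sq_nonneg _
  have hsq : ∀ k, ∫ ω, Y k ω ^ 2 ∂P = lam k ^ 2 * τ := fun k => by
    calc ∫ ω, Y k ω ^ 2 ∂P = ∫ ω, lam k ^ 2 * (Y k ω / lam k) ^ 2 ∂P :=
          integral_congr_ae (ae_of_all _ fun ω => by
            beta_reduce
            rw [← mul_pow, ← hYW])
      _ = lam k ^ 2 * τ := by
          rw [integral_const_mul]
          exact congrArg _ (hid k).sq.integral_eq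
  -- Dividing by `√τ + 1` instead of `√τ` avoids having to prove `τ` positive, and `√τ / (√τ + 1) ≤
  -- 1` is all that is used.
  refine ⟨δ, hδ, ε / (√τ + 1), by positivity, fun s c r hr => ?_⟩
  have := h s (fun k => c k * lam k) r (hr.trans (by
    simp only [hsq, ← mul_assoc, ← Finset.sum_mul, ← mul_pow]
    rw [Real.sqrt_mul' _ hτ0, div_mul_eq_mul_div, div_le_iff₀ (by positivity)]
    have : 0 ≤ ε * √(∑ k ∈ s, (c k * lam k) ^ 2) := by positivity
    linarith))
  simpa only [mul_assoc, ← hYW] using this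

end Depth

theorem theorem2 {B : Type*} [AddCommGroup B] [Module ℝ B] [MetricSpace B]
    [IsTopologicalAddGroup B] [ContinuousSMul ℝ B] [CompleteSpace B]
    [TopologicalSpace.SeparableSpace B]
    (hdist : ∀ x y z : B, dist (x + z) (y + z) = dist x y)
    [MeasurableSpace B] [BorelSpace B]
    {Ω : Type*} [MeasurableSpace Ω] (P : Measure Ω) [IsProbabilityMeasure P]
    (X : Ω → B) (hX : Measurable X)
    (t : ℕ → B → ℝ) (ht : ∀ k, Measurable (t k))
    (h_indep : iIndepFun (fun k ω => t k (X ω)) P)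
    (h_symm : ∀ k, IdentDistrib (fun ω => t k (X ω)) (fun ω => -t k (X ω)) P P)
    (σ : ℕ → ℝ) (hσ : ∀ k, 0 < σ k)
    (h_memLp : ∀ k, MemLp (fun ω => t k (X ω)) 2 P)
    (h_var : ∀ k, variance (fun ω => t k (X ω)) P = σ k ^ 2)
    (a : B)
    (h : (PositiveFiniteDimDepth t a (P.map X) ∧ FourthMomentBound P (fun k ω => t k (X ω))) ∨
      ScaledIIDRegularDensity P (fun k ω => t k (X ω))) :
    0 < halfSpaceDepth (finiteCombinations t) a (P.map X) ↔
      Summable (fun k => t k a ^ 2 / σ k ^ 2) := by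
  have hYm : ∀ k, Measurable fun ω => t k (X ω) := fun k => (ht k).comp hX
  have h0 := fun k => integral_eq_zero_of_identDistrib_neg (h_symm k)
  have hvar : ∀ k, ∫ ω, t k (X ω) ^ 2 ∂P = σ k ^ 2 := fun k => by
    rw [← h_var k, variance_of_integral_eq_zero (hYm k).aemeasurable (h0 k)]
  refine ⟨summable_of_halfSpaceDepth_pos hX ht h_indep h_memLp h0 hσ hvar, ?_⟩
  rcases h with ⟨hfin, h4⟩ | hiid
  · refine halfSpaceDepth_pos_of_summable hX ht h_indep hσ
      (exists_lower_bound_range_of_positiveFiniteDimDepth hX ht hfin) ?_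
    simpa only [hvar] using
      exists_uniform_lower_bound_of_fourthMomentBound hYm h_indep h_symm h4
  · refine halfSpaceDepth_pos_of_summable hX ht h_indep hσ
      (exists_lower_bound_range_of_scaledIIDRegularDensity h_indep hiid fun k => t k a) ?_
    simpa only [hvar] using
      exists_uniform_lower_bound_of_scaledIIDRegularDensity hYm h_symm hiid
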